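/- Let $X$ be a real or complex Banach space with closed unit ball $B_X$, and regard $X$ as a subspace of $X^{**}$ via the canonical embedding. Definitions. A subset $B$ of a weak*-compact convex subset $K$ of a dual space is said to (I)-generate $K$ if, whenever $B=\bigcup_{n=1}^\infty B_n$, the set $K$ is the norm-closed convex hull of $\bigcup_{n=1}^\infty \overline{\mathrm{co}}^{\,w^*}(B_n)$, where $\overline{\mathrm{co}}^{\,w^*}$ denotes the weak*-closed convex hull. An infinite matrix $A=(a_{nk})_{n,k\in\mathbb N}$ is positive regular if $a_{nk}\ge 0$ for all $n,k$ and, for every scalar sequence $s_k\to s$, all the series $\sum_{k=1}^\infty a_{nk}s_k$ converge and $\lim_{n\to\infty}\sum_{k=1}^\infty a_{nk}s_k=s$. For such $A$, a scalar sequence $(s_k)$ is strongly $A$-convergent to $s$ if $\sum_{k=1}^\infty a_{nk}|s_k-s|<\infty$ for every $n$ and $\lim_{n\to\infty}\sum_{k=1}^\infty a_{nk}|s_k-s|=0$. It is statistically convergent to $s$ if $\lim_{n\to\infty}\frac1n|\{k\le n:|s_k-s|\ge\varepsilon\}|=0$ for every $\varepsilon>0$. The ball $B_{X^*}$ is weak*-statistically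 sequentially compact if every sequence in $B_{X^*}$ has a subsequence $(x^*_{n_k})_{k}$ for which there is $x^*\in X^*$ such that $(x^*_{n_k}(x))_{k}$ is statistically convergent to $x^*(x)$ for every $x\in X$. Corollary 3.8. Suppose that $B_X$ (I)-generates $B_{X^{**}}$, viewed as a weak*-compact convex subset of the dual $X^{**}$ of $X^*$. (a) If for each sequence $(x_n^*)_{n\in\mathbb N}$ in $B_{X^*}$ there are a positive regular matrix $A$ and an $x^*\in X^*$ such that $(x_n^*(x))_{n\in\mathbb N}$ is strongly $A$-convergent to $x^*(x)$ for all $x\in X$, then $X$ is reflexive. (b) In particular, if $B_{X^*}$ is weak*-statistically sequentially compact, then $X$ is reflexive. -/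

import Mathlib

open Filter Topology

noncomputable section

/-! ### Matrix summability and statistical convergence -/

/-- The sequence `s` of complex numbers is `A`-convergent to `l`: every series `∑ₖ a n k * s k`
converges (in the ordinary sense, not necessarily absolutely), and the sums `t n` tend to `l`. -/
def IsMatrixConvergent (A : ℕ → ℕ → ℂ) (s : ℕ → ℂ) (l : ℂ) : Prop :=
  ∃ t : ℕ → ℂ,
    (∀ n, Tendsto (fun N => ∑ k ∈ Finset.range N, A n k * s k) atTop (𝓝 (t n))) ∧
      Tendsto t atTop (𝓝 l)

/-- `A` is regular: every convergent sequence is `A`-convergent to the same limit. -/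
def IsRegularMatrix (A : ℕ → ℕ → ℂ) : Prop :=
  ∀ (s : ℕ → ℂ) (l : ℂ), Tendsto s atTop (𝓝 l) → IsMatrixConvergent A s l

/-- `A` is a positive regular matrix: all entries are real and nonnegative, and `A` is regular. -/
structure IsPositiveRegularMatrix (A : ℕ → ℕ → ℝ) : Prop where
  nonneg : ∀ n k, 0 ≤ A n k
  regular : IsRegularMatrix fun n k => (A n k : ℂ)

/-- `s` is strongly `A`-convergent to `l` (for a matrix `A` with nonnegative entries): the series
`∑ₖ a n k * |s k - l|` of nonnegative terms are convergent, and their sums tend to `0`. -/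
def IsStronglyConvergent {𝕜 : Type*} [RCLike 𝕜] (A : ℕ → ℕ → ℝ) (s : ℕ → 𝕜) (l : 𝕜) : Prop :=
  (∀ n, Summable fun k => A n k * ‖s k - l‖) ∧
    Tendsto (fun n => ∑' k, A n k * ‖s k - l‖) atTop (𝓝 0)

open Classical in
/-- `s` is statistically convergent to `l`: for every `ε > 0`, the proportion of indices among the
first `n` for which `|s k - l| ≥ ε` tends to `0`. (Sequences are indexed from `0`.) -/
def IsStatisticallyConvergent {𝕜 : Type*} [RCLike 𝕜] (s : ℕ → 𝕜) (l : 𝕜) : Prop :=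
  ∀ ε : ℝ, 0 < ε →
    Tendsto (fun n : ℕ => (((Finset.range n).filter fun k => ε ≤ ‖s k - l‖).card : ℝ) / n)
      atTop (𝓝 0)

/-! ### Dual spaces -/

/-- The weak*-closed convex hull of a subset of the dual of `E`. -/
def weakStarClosedConvexHull {𝕜 : Type*} [RCLike 𝕜] {E : Type*} [NormedAddCommGroup E]
    [NormedSpace 𝕜 E] (S : Set (StrongDual 𝕜 E)) : Set (StrongDual 𝕜 E) :=
  StrongDual.toWeakDual ⁻¹' closure (StrongDual.toWeakDual '' convexHull ℝ S)

/-- `B` (I)-generates `K`, for a subset `B` of a weak*-compact convex subset `K` of the dual of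
`E`: whenever `B = ⋃ₙ C n`, the set `K` is the norm-closed convex hull of the union of the
weak*-closed convex hulls of the sets `C n`. -/
def IGenerates {𝕜 : Type*} [RCLike 𝕜] {E : Type*} [NormedAddCommGroup E] [NormedSpace 𝕜 E]
    (B K : Set (StrongDual 𝕜 E)) : Prop :=
  B ⊆ K ∧ ∀ C : ℕ → Set (StrongDual 𝕜 E), B = ⋃ n, C n →
    K = closure (convexHull ℝ (⋃ n, weakStarClosedConvexHull (C n)))

/-- `M` is weak*-statistically sequentially compact: every sequence in `M` has a subsequence which
converges statistically, at every point of `E`, to some functional. The limit is not required to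
lie in `M`; when `M` is a closed ball it automatically does. -/
def IsWeakStarStatSeqCompact {𝕜 : Type*} [RCLike 𝕜] {E : Type*} [NormedAddCommGroup E]
    [NormedSpace 𝕜 E] (M : Set (StrongDual 𝕜 E)) : Prop :=
  ∀ f : ℕ → StrongDual 𝕜 E, (∀ n, f n ∈ M) →
    ∃ (φ : ℕ → ℕ) (g : StrongDual 𝕜 E), StrictMono φ ∧
      ∀ x : E, IsStatisticallyConvergent (fun k => f (φ k) x) (g x)

/-- `X` is reflexive: the canonical embedding of `X` into its bidual is onto. -/
def IsReflexiveSpace (𝕜 : Type*) [RCLike 𝕜] (X : Type*) [NormedAddCommGroup X]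
    [NormedSpace 𝕜 X] : Prop :=
  Function.Surjective (NormedSpace.inclusionInDoubleDual 𝕜 X)

end

/-! ### Goldstine's theorem on finite sets of functionals -/

section Goldstine

variable {𝕜 : Type*} [RCLike 𝕜] {E : Type*} [NormedAddCommGroup E] [NormedSpace 𝕜 E]

/-! Argue by contradiction. A nonreflexive `X` carries James' triangular array
(`exists_james_sequences`): `f n (x k)` is nearly `0` for `k < n` and nearly `c ≠ 0` for `n ≤ k`.
Let `g` be the strong `A`-limit of a subsequence of `f`, and `F` a weak* cluster point of `x` in the
bidual. Then `g` is small on every `x k`, so `F g` is small, while every `F (f n)` is near `c`.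

(I)-generation forbids this (`IGenerates.isStronglyNull`). The sets where all rows from `m` on are
at most `ε / 2` are convex, weak*-closed and increasing in `m`, and they cover the image of `B_X`.
Hence their union is norm-dense in the bidual ball, and boundedness of the row sums carries strong
nullity to all of it. So `F (f (φ k) - g)` comes arbitrarily close to `0`, a contradiction.

The statistical version reduces to this one through the Cesàro matrix. -/

theorem norm_le_of_re_le_on_closedBall (f : StrongDual 𝕜 E) (u : ℝ)
    (h : ∀ x ∈ Metric.closedBall (0 : E) 1, RCLike.re (f x) ≤ u) : ‖f‖ ≤ u := by
  rw [← ContinuousLinearMap.sSup_unitClosedBall_eq_norm f]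
  refine csSup_le ⟨_, ⟨0, by simp, rfl⟩⟩ ?_
  rintro _ ⟨x, hx, rfl⟩
  -- Rotating `x` by a unimodular scalar makes `f x` real and nonnegative.
  obtain ⟨c, hc, hcx⟩ := RCLike.exists_norm_mul_eq_self (f x)
  have hc0 : c ≠ 0 := by
    rintro rfl
    simp at hc
  have key : f (c⁻¹ • x) = (‖f x‖ : 𝕜) := by
    rw [map_smul, smul_eq_mul]
    rw [inv_mul_eq_iff_eq_mul₀ hc0, hcx]
  have := h (c⁻¹ • x) (by simpa [norm_smul, hc] using hx)
  rw [key, RCLike.ofReal_re] at this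
  exact this

/-- **Goldstine's theorem**, in the form of approximation on a finite set of functionals. -/
theorem exists_mem_closedBall_forall_norm_sub_lt (ξ : StrongDual 𝕜 (StrongDual 𝕜 E))
    (hξ : ‖ξ‖ ≤ 1) (s : Finset (StrongDual 𝕜 E)) {ε : ℝ} (hε : 0 < ε) :
    ∃ x ∈ Metric.closedBall (0 : E) 1, ∀ f ∈ s, ‖f x - ξ f‖ < ε := by
  let _ : NormedSpace ℝ E := NormedSpace.restrictScalars ℝ 𝕜 E
  have : IsScalarTower ℝ 𝕜 E := RestrictScalars.isScalarTower ℝ 𝕜 E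
  classical
  let T : E →L[𝕜] (s → 𝕜) := ContinuousLinearMap.pi fun f => (f : StrongDual 𝕜 E)
  let S : Set (s → 𝕜) := T '' Metric.closedBall 0 1
  have hS : Convex ℝ S :=
    (convex_closedBall (0 : E) 1).is_linear_image
      (T.restrictScalars ℝ).toLinearMap.isLinear
  have hmem : (fun f : s => ξ f) ∈ closure S := by
    by_contra hnot
    obtain ⟨l, u, hl, hu⟩ :=
      RCLike.geometric_hahn_banach_closed_point (𝕜 := 𝕜) hS.closure isClosed_closure hnot
    -- The separating `l` becomes a single functional on `E`: `l ∘ T = φ`, and `l` at the excluded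
    -- point is `ξ φ`.
    let φ : StrongDual 𝕜 E := ∑ f : s, l (Pi.single f 1) • (f : StrongDual 𝕜 E)
    have hlφ (y : s → 𝕜) : l y = ∑ f : s, l (Pi.single f 1) * y f := by
      conv_lhs => rw [pi_eq_sum_univ' y]
      rw [map_sum]
      refine Finset.sum_congr rfl fun f _ => ?_
      rw [map_smul, smul_eq_mul, mul_comm]
    have hφ : ‖φ‖ ≤ u := by
      refine norm_le_of_re_le_on_closedBall φ u fun x hx => ?_
      have h1 := hl (T x) (subset_closure ⟨x, hx, rfl⟩)
      rw [hlφ] at h1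
      simpa [φ, T] using h1.le
    have hξφ : ξ φ = l fun f : s => ξ f := by
      rw [hlφ]
      simp [φ]
    have h2 : ‖ξ φ‖ ≤ ‖φ‖ := by
      simpa using ξ.le_of_opNorm_le hξ φ
    have h3 := (RCLike.re_le_norm (ξ φ)).trans (h2.trans hφ)
    rw [hξφ] at h3
    exact absurd hu h3.not_gt
  obtain ⟨_, ⟨x, hx, rfl⟩, hd⟩ := Metric.mem_closure_iff.1 hmem ε hε
  refine ⟨x, hx, fun f hf => ?_⟩
  rw [dist_comm, dist_eq_norm] at hd
  exact (norm_le_pi_norm (T x - fun f : s => ξ f) ⟨f, hf⟩).trans_lt hd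

end Goldstine

/-! ### James' triangular sequences in nonreflexive spaces -/

section JamesSequences

variable {𝕜 : Type*} [RCLike 𝕜] {E : Type*} [NormedAddCommGroup E] [NormedSpace 𝕜 E]

theorem exists_dual_eq_zero_on_of_notMem (S : Submodule 𝕜 E) (hS : IsClosed (S : Set E)) {v : E}
    (hv : v ∉ S) : ∃ G : StrongDual 𝕜 E, ‖G‖ ≤ 1 ∧ (∀ x ∈ S, G x = 0) ∧ G v ≠ 0 := by
  -- Instance search needs closedness to make the quotient normed rather than only seminormed.
  have := hS
  have hne : S.mkQ v ≠ 0 := by simpa using hv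
  obtain ⟨g, hg, hgv⟩ := exists_dual_vector'' 𝕜 (S.mkQ v)
  refine ⟨g.comp S.mkQL, ?_, fun x hx => ?_, ?_⟩
  · refine ContinuousLinearMap.opNorm_le_bound _ zero_le_one fun x => ?_
    have h1 : ‖g (S.mkQ x)‖ ≤ 1 * ‖S.mkQ x‖ := g.le_of_opNorm_le hg _
    have h2 : ‖S.mkQ x‖ ≤ ‖x‖ := Submodule.Quotient.norm_mk_le S x
    simp only [one_mul] at h1 ⊢
    exact h1.trans h2
  · have : S.mkQ x = 0 := by simpa using hx
    change g (S.mkQ x) = 0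
    rw [this, map_zero]
  · change g (S.mkQ v) ≠ 0
    rw [hgv]
    exact_mod_cast norm_ne_zero_iff.2 hne

variable {X : Type*} [NormedAddCommGroup X] [NormedSpace 𝕜 X] [CompleteSpace X]

/-- Completeness of `X` makes the range of `J` closed. Normalising `w` allows Goldstine's theorem to
be applied to `v` later on. -/
theorem exists_dual_comp_eq_zero_of_ne (J : X →L[𝕜] E)
    (hnorm : ∀ x, ‖J x‖ = ‖x‖) {w : E} (hw : ∀ x, J x ≠ w) :
    ∃ (v : E) (G : StrongDual 𝕜 E), ‖v‖ ≤ 1 ∧ ‖G‖ ≤ 1 ∧ (∀ x, G (J x) = 0) ∧ G v ≠ 0 := by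
  obtain ⟨G, hG, hGS, hGw⟩ := exists_dual_eq_zero_on_of_notMem (LinearMap.range J.toLinearMap)
    (AddMonoidHomClass.isometry_of_norm J hnorm).isClosedEmbedding.isClosed_range (v := w) (fun ⟨x, hx⟩ => hw x hx)
  have hw0 : ‖w‖ ≠ 0 := by
    refine norm_ne_zero_iff.2 ?_
    rintro rfl
    exact hGw (map_zero G)
  refine ⟨(‖w‖ : 𝕜)⁻¹ • w, G, ?_, hG, fun x => hGS _ ⟨x, rfl⟩, ?_⟩
  · rw [norm_smul, norm_inv, RCLike.norm_ofReal, abs_norm, inv_mul_cancel₀ hw0]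
  · rw [map_smul]
    exact smul_ne_zero (inv_ne_zero (by exact_mod_cast hw0)) hGw

/-- If an isometric copy of a complete space in a dual space misses a functional, then some functional
`ξ` in the unit ball can be separated from finite subsets of this copy by vectors in the unit
ball. -/
theorem exists_functional_separated_from_range (J : X →L[𝕜] StrongDual 𝕜 E)
    (hnorm : ∀ x, ‖J x‖ = ‖x‖) {w : StrongDual 𝕜 E} (hw : ∀ x, J x ≠ w) :
    ∃ (ξ : StrongDual 𝕜 E) (c : 𝕜), ‖ξ‖ ≤ 1 ∧ c ≠ 0 ∧ ∀ (s : Finset X) (ε : ℝ), 0 < ε →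
      ∃ y : E, ‖y‖ ≤ 1 ∧ ‖ξ y - c‖ < ε ∧ ∀ x ∈ s, ‖J x y‖ < ε := by
  obtain ⟨ξ, G, hξ, hG, hGJ, hGξ⟩ := exists_dual_comp_eq_zero_of_ne J hnorm hw
  refine ⟨ξ, G ξ, hξ, hGξ, fun s ε hε => ?_⟩
  classical
  obtain ⟨y, hy, hys⟩ := exists_mem_closedBall_forall_norm_sub_lt G hG
    (insert ξ (s.image J)) hε
  refine ⟨y, by simpa using hy, hys ξ (Finset.mem_insert_self _ _), fun x hx => ?_⟩
  simpa [hGJ x] using hys (J x) (Finset.mem_insert_of_mem (Finset.mem_image_of_mem _ hx))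

/-- James' sequences: in a nonreflexive space there are sequences of functionals `f` and of vectors
`x` in the unit balls such that `f n (x k)` is close to zero for `k < n`, and close to some fixed
nonzero scalar for `n ≤ k`. -/
theorem exists_james_sequences (h : ¬ IsReflexiveSpace 𝕜 X) :
    ∃ c : 𝕜, c ≠ 0 ∧ ∀ ε : ℝ, 0 < ε → ∃ (f : ℕ → StrongDual 𝕜 X) (x : ℕ → X),
      (∀ n, ‖f n‖ ≤ 1) ∧ (∀ n, ‖x n‖ ≤ 1) ∧ (∀ k n, k < n → ‖f n (x k)‖ ≤ ε) ∧
        ∀ n k, n ≤ k → ‖f n (x k) - c‖ ≤ ε := by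
  obtain ⟨η, hη⟩ : ∃ η, ∀ x, NormedSpace.inclusionInDoubleDual 𝕜 X x ≠ η := by
    simpa [IsReflexiveSpace, Function.Surjective] using h
  have hnorm (x : X) : ‖NormedSpace.inclusionInDoubleDual 𝕜 X x‖ = ‖x‖ :=
    (NormedSpace.inclusionInDoubleDualLi 𝕜 (E := X)).norm_map x
  obtain ⟨ξ, c, hξ, hc, hsep⟩ := exists_functional_separated_from_range
    (NormedSpace.inclusionInDoubleDual 𝕜 X) hnorm hη
  refine ⟨c, hc, fun ε hε => ?_⟩
  classical
  obtain ⟨p, hp, hr⟩ := exists_seq_of_forall_finset_exists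
    (fun p : StrongDual 𝕜 X × X =>
      ‖p.1‖ ≤ 1 ∧ ‖p.2‖ ≤ 1 ∧ ‖ξ p.1 - c‖ < ε / 2 ∧ ‖p.1 p.2 - c‖ ≤ ε)
    (fun p q => ‖q.1 p.2‖ ≤ ε ∧ ‖p.1 q.2 - c‖ ≤ ε) (by
      intro s hs
      -- The functional is chosen first, against the earlier vectors; then the vector imitates `ξ`
      -- on the new and all earlier functionals. The two halves of `ε` add up in `combine`.
      obtain ⟨f, hf, hfξ, hfs⟩ := hsep (s.image Prod.snd) (ε / 2) (half_pos hε)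
      obtain ⟨x, hx, hxs⟩ := exists_mem_closedBall_forall_norm_sub_lt ξ hξ
        (insert f (s.image Prod.fst)) (half_pos hε)
      have combine (g : StrongDual 𝕜 X) (h1 : ‖g x - ξ g‖ < ε / 2) (h2 : ‖ξ g - c‖ < ε / 2) :
          ‖g x - c‖ ≤ ε := by
        have := norm_sub_le_norm_sub_add_norm_sub (g x) (ξ g) (c)
        linarith
      refine ⟨(f, x), ⟨hf, by simpa using hx, hfξ,
        combine f (hxs f (Finset.mem_insert_self _ _)) hfξ⟩, fun q hq => ⟨?_, ?_⟩⟩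
      · exact (hfs q.2 (Finset.mem_image_of_mem _ hq)).le.trans (half_le_self hε.le)
      · exact combine q.1 (hxs q.1 (Finset.mem_insert_of_mem (Finset.mem_image_of_mem _ hq)))
          (hs q hq).2.2.1)
  refine ⟨fun n => (p n).1, fun n => (p n).2, fun n => (hp n).1, fun n => (hp n).2.1,
    fun k n hkn => (hr k n hkn).1, fun n k hnk => ?_⟩
  rcases hnk.eq_or_lt with rfl | hlt
  · exact (hp n).2.2.2
  · exact (hr n k hlt).2

end JamesSequences

/-! ### Positive regular matrices -/

section MatrixSummability

variable {𝕜 : Type*} [RCLike 𝕜]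

/-- `y` is strongly summed to zero by the matrix `A`, expressed through finite partial sums. -/
def IsStronglyNull (A : ℕ → ℕ → ℝ) (y : ℕ → 𝕜) : Prop :=
  ∀ ε : ℝ, 0 < ε → ∀ᶠ n in atTop, ∀ N, ∑ k ∈ Finset.range N, A n k * ‖y k‖ ≤ ε

theorem IsPositiveRegularMatrix.isStronglyNull {A : ℕ → ℕ → ℝ} (hA : IsPositiveRegularMatrix A)
    {s : ℕ → 𝕜} {l : 𝕜} (h : IsStronglyConvergent A s l) :
    IsStronglyNull A fun k => s k - l := by
  intro ε hε
  filter_upwards [h.2.eventually_le_const hε] with n hn N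
  exact ((h.1 n).sum_le_tsum _ fun k _ => mul_nonneg (hA.nonneg n k) (norm_nonneg _)).trans hn

/-- Regularity tested on the indicator of a tail: asymptotically, all row mass lies beyond any `K`.
-/
theorem IsPositiveRegularMatrix.exists_sum_indicator {A : ℕ → ℕ → ℝ}
    (hA : IsPositiveRegularMatrix A) (K : ℕ) :
    ∃ t : ℕ → ℝ,
      (∀ n, Tendsto (fun N => ∑ k ∈ Finset.range N, A n k * if K ≤ k then 1 else 0) atTop
        (𝓝 (t n))) ∧ Tendsto t atTop (𝓝 1) := by
  obtain ⟨t, ht, ht1⟩ := hA.regular (fun k => if K ≤ k then 1 else 0) 1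
    (tendsto_const_nhds.congr' (by
      filter_upwards [eventually_ge_atTop K] with k hk
      simp [hk]))
  refine ⟨fun n => (t n).re, fun n => ?_, (Complex.continuous_re.tendsto _).comp ht1⟩
  refine ((Complex.continuous_re.tendsto _).comp (ht n)).congr fun N => ?_
  simp only [Function.comp_apply, Complex.re_sum]
  refine Finset.sum_congr rfl fun k _ => ?_
  split_ifs <;> simp

theorem IsPositiveRegularMatrix.eventually_sum_le_two {A : ℕ → ℕ → ℝ}
    (hA : IsPositiveRegularMatrix A) :
    ∀ᶠ n in atTop, ∀ N, ∑ k ∈ Finset.range N, A n k ≤ 2 := by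
  obtain ⟨t, ht, ht1⟩ := hA.exists_sum_indicator 0
  filter_upwards [ht1.eventually_le_const one_lt_two] with n hn N
  have hmono : Monotone fun N => ∑ k ∈ Finset.range N, A n k :=
    fun a b hab => Finset.sum_le_sum_of_subset_of_nonneg (Finset.range_mono hab)
      fun k _ _ => hA.nonneg n k
  exact (hmono.ge_of_tendsto (by simpa using ht n) N).trans hn

/-- A sequence strongly summed to zero by a positive regular matrix clusters at zero. -/
theorem IsStronglyNull.exists_norm_lt {A : ℕ → ℕ → ℝ} (hA : IsPositiveRegularMatrix A)
    {y : ℕ → 𝕜} (hy : IsStronglyNull A y) {δ : ℝ} (hδ : 0 < δ) (K : ℕ) :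
    ∃ k, K ≤ k ∧ ‖y k‖ < δ := by
  by_contra! hcon
  obtain ⟨t, ht, ht1⟩ := hA.exists_sum_indicator K
  -- A row with tail mass above `1 / 2` has weighted sum above `δ / 2` if all tail terms are at
  -- least `δ`.
  obtain ⟨n, hn, hn'⟩ := ((ht1.eventually_const_lt one_half_lt_one).and
    (hy (δ / 2) (half_pos hδ))).exists
  obtain ⟨N, hN⟩ := ((ht n).eventually_const_lt hn).exists
  have h1 : (∑ k ∈ Finset.range N, A n k * if K ≤ k then 1 else 0) * δ ≤ δ / 2 := by
    refine le_trans ?_ (hn' N)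
    rw [Finset.sum_mul]
    refine Finset.sum_le_sum fun k _ => ?_
    rw [mul_assoc]
    refine mul_le_mul_of_nonneg_left ?_ (hA.nonneg n k)
    split_ifs with hk
    · simpa using hcon k hk
    · simp
  nlinarith

end MatrixSummability

/-! ### Passing strong nullity through (I)-generation -/

section Extension

variable {𝕜 : Type*} [RCLike 𝕜] {E : Type*} [NormedAddCommGroup E] [NormedSpace 𝕜 E]

theorem weakStarClosedConvexHull_subset {S D : Set (StrongDual 𝕜 E)} (hSD : S ⊆ D)
    (hD : Convex ℝ D) (hcl : IsClosed (StrongDual.toWeakDual '' D)) :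
    weakStarClosedConvexHull S ⊆ D := by
  intro F hF
  have h1 := closure_minimal (Set.image_mono (convexHull_min hSD hD)) hcl hF
  obtain ⟨F', hF', he⟩ := h1
  rwa [← StrongDual.toWeakDual.injective he]

/-- The functionals at which the partial sums of the rows `n ≥ m` are at most `ε`. -/
def rowSublevel (A : ℕ → ℕ → ℝ) (h : ℕ → E) (ε : ℝ) (m : ℕ) : Set (StrongDual 𝕜 E) :=
  {F | ∀ n, m ≤ n → ∀ N, ∑ k ∈ Finset.range N, A n k * ‖F (h k)‖ ≤ ε}

theorem convex_rowSublevel {A : ℕ → ℕ → ℝ} (hA : ∀ n k, 0 ≤ A n k) (h : ℕ → E) (ε : ℝ) (m : ℕ) :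
    Convex ℝ (rowSublevel A h ε m : Set (StrongDual 𝕜 E)) := by
  intro F hF G hG a b ha hb hab n hn N
  have h1 := mul_le_mul_of_nonneg_left (hF n hn N) ha
  have h2 := mul_le_mul_of_nonneg_left (hG n hn N) hb
  have h3 : a * ε + b * ε = ε := by rw [← add_mul, hab, one_mul]
  refine le_trans ?_ ((add_le_add h1 h2).trans_eq h3)
  rw [Finset.mul_sum, Finset.mul_sum, ← Finset.sum_add_distrib]
  refine Finset.sum_le_sum fun k _ => ?_
  have h4 : ‖(a • F + b • G) (h k)‖ ≤ a * ‖F (h k)‖ + b * ‖G (h k)‖ := by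
    refine (norm_add_le _ _).trans_eq ?_
    simp [norm_smul, abs_of_nonneg ha, abs_of_nonneg hb]
  exact (mul_le_mul_of_nonneg_left h4 (hA n k)).trans_eq (by ring)

/-- Each finite partial sum is weak*-continuous in `F`, which is why rows are bounded through
partial sums. -/
theorem isClosed_rowSublevel (A : ℕ → ℕ → ℝ) (h : ℕ → E) (ε : ℝ) (m : ℕ) :
    IsClosed (StrongDual.toWeakDual '' (rowSublevel A h ε m : Set (StrongDual 𝕜 E))) := by
  have : StrongDual.toWeakDual '' (rowSublevel A h ε m : Set (StrongDual 𝕜 E)) =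
      ⋂ (n) (_ : m ≤ n) (N), {F : WeakDual 𝕜 E |
        ∑ k ∈ Finset.range N, A n k * ‖F (h k)‖ ≤ ε} := by
    ext F
    simp only [Set.mem_image, Set.mem_iInter, Set.mem_ofPred_eq]
    constructor
    · rintro ⟨F, hF, rfl⟩
      exact hF
    · intro hF
      exact ⟨WeakDual.toStrongDual F, hF, rfl⟩
  rw [this]
  refine isClosed_iInter fun n => isClosed_iInter fun _ => isClosed_iInter fun N =>
    isClosed_le ?_ continuous_const
  exact continuous_finsetSum _ fun k _ => ((WeakDual.eval_continuous (h k)).norm).const_mul _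

theorem rowSublevel_mono (A : ℕ → ℕ → ℝ) (h : ℕ → E) (ε : ℝ) :
    Monotone fun m => (rowSublevel A h ε m : Set (StrongDual 𝕜 E)) :=
  fun _ _ hab _ hF n hn N => hF n (hab.trans hn) N

/-- Strong nullity along a bounded sequence passes from a set to anything it (I)-generates. -/
theorem IGenerates.isStronglyNull {B K : Set (StrongDual 𝕜 E)} (hgen : IGenerates B K)
    {A : ℕ → ℕ → ℝ} (hA : IsPositiveRegularMatrix A) {h : ℕ → E} {C : ℝ} (hC : ∀ k, ‖h k‖ ≤ C)
    (hB : ∀ F ∈ B, IsStronglyNull A fun k => F (h k)) {F : StrongDual 𝕜 E} (hF : F ∈ K) :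
    IsStronglyNull A fun k => F (h k) := by
  intro ε hε
  let D : ℕ → Set (StrongDual 𝕜 E) := rowSublevel A h (ε / 2)
  have hcover : B = ⋃ m, B ∩ D m := by
    rw [← Set.inter_iUnion, eq_comm, Set.inter_eq_left]
    intro G hG
    obtain ⟨m, hm⟩ := eventually_atTop.1 (hB G hG (ε / 2) (half_pos hε))
    exact Set.mem_iUnion.2 ⟨m, hm⟩
  have hconv : Convex ℝ (⋃ m, D m) :=
    (rowSublevel_mono A h (ε / 2)).directed_le.convex_iUnion
      fun m => convex_rowSublevel hA.nonneg h (ε / 2) m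
  have hsub : convexHull ℝ (⋃ m, weakStarClosedConvexHull (B ∩ D m)) ⊆ ⋃ m, D m :=
    convexHull_min (Set.iUnion_mono fun m => weakStarClosedConvexHull_subset
      Set.inter_subset_right (convex_rowSublevel hA.nonneg h (ε / 2) m)
      (isClosed_rowSublevel A h (ε / 2) m)) hconv
  rw [hgen.2 _ hcover] at hF
  have hC0 : 0 ≤ C := (norm_nonneg _).trans (hC 0)
  -- Row sums are eventually at most `2`, so replacing `F` by `F'` costs at most `2 * (ε / 4)`, on
  -- top of the `ε / 2` from `D m`.
  obtain ⟨F', hF', hd⟩ := Metric.mem_closure_iff.1 hF (ε / (4 * (C + 1))) (by positivity)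
  obtain ⟨m, hm⟩ := Set.mem_iUnion.1 (hsub hF')
  rw [dist_eq_norm] at hd
  have hη : ‖F - F'‖ * C ≤ ε / 4 := by
    rw [lt_div_iff₀ (by positivity)] at hd
    nlinarith [norm_nonneg (F - F')]
  filter_upwards [hA.eventually_sum_le_two, eventually_ge_atTop m] with n hn hmn N
  have h1 : ∑ k ∈ Finset.range N, A n k * ‖F (h k)‖ ≤
      ∑ k ∈ Finset.range N, A n k * ‖F' (h k)‖ + (∑ k ∈ Finset.range N, A n k) * (ε / 4) := by
    rw [Finset.sum_mul, ← Finset.sum_add_distrib]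
    refine Finset.sum_le_sum fun k _ => ?_
    rw [← mul_add]
    refine mul_le_mul_of_nonneg_left ?_ (hA.nonneg n k)
    have h2 : ‖(F - F') (h k)‖ ≤ ‖F - F'‖ * C := (F - F').le_of_opNorm_le_of_le le_rfl (hC k)
    have h3 : ‖F (h k)‖ ≤ ‖F' (h k)‖ + ‖(F - F') (h k)‖ := by
      simpa using norm_le_norm_add_norm_sub' (F (h k)) (F' (h k))
    linarith
  have h4 := hm n hmn N
  have h5 := hn N
  nlinarith

end Extension

/-! ### The contradiction in the bidual -/

section Reflexivity

variable {𝕜 : Type*} [RCLike 𝕜] {X : Type*} [NormedAddCommGroup X] [NormedSpace 𝕜 X]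

/-- A functional in the weak*-closure of all tails of a sequence of vectors in the unit ball. -/
theorem exists_bidual_cluster (x : ℕ → X) (hx : ∀ n, ‖x n‖ ≤ 1) :
    ∃ F ∈ Metric.closedBall (0 : StrongDual 𝕜 (StrongDual 𝕜 X)) 1,
      ∀ (f : StrongDual 𝕜 X) (c : 𝕜) (r : ℝ), (∀ᶠ k in atTop, ‖f (x k) - c‖ ≤ r) →
        ‖F f - c‖ ≤ r := by
  let u : ℕ → WeakDual 𝕜 (StrongDual 𝕜 X) := fun n =>
    StrongDual.toWeakDual (NormedSpace.inclusionInDoubleDual 𝕜 X (x n))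
  obtain ⟨F, hF, hclus⟩ := (WeakDual.isCompact_closedBall
    (0 : StrongDual 𝕜 (StrongDual 𝕜 X)) 1).exists_mapClusterPt (f := atTop) (u := u)
      (le_principal_iff.2 (mem_map.2 (Eventually.of_forall fun n => by
        have := (NormedSpace.double_dual_bound 𝕜 X (x n)).trans (hx n)
        simpa [u] using this)))
  refine ⟨WeakDual.toStrongDual F, hF, fun f c r hfr => ?_⟩
  have hcl : IsClosed {G : WeakDual 𝕜 (StrongDual 𝕜 X) | ‖G f - c‖ ≤ r} :=
    isClosed_le ((WeakDual.eval_continuous f).sub continuous_const).norm continuous_const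
  exact hcl.mem_of_mapClusterPt hclus hfr

/-- If `B_X` (I)-generates the unit ball of the bidual, and every sequence in the dual unit ball
has a subsequence that is pointwise strongly convergent with respect to some positive regular
matrix, then `X` is reflexive. -/
theorem isReflexiveSpace_of_iGenerates [CompleteSpace X]
    (hgen : IGenerates
      (NormedSpace.inclusionInDoubleDual 𝕜 X '' Metric.closedBall (0 : X) 1)
      (Metric.closedBall (0 : StrongDual 𝕜 (StrongDual 𝕜 X)) 1))
    (H : ∀ f : ℕ → StrongDual 𝕜 X, (∀ n, f n ∈ Metric.closedBall (0 : StrongDual 𝕜 X) 1) →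
      ∃ (φ : ℕ → ℕ) (A : ℕ → ℕ → ℝ) (g : StrongDual 𝕜 X), StrictMono φ ∧
        IsPositiveRegularMatrix A ∧ ∀ x : X, IsStronglyConvergent A (fun n => f (φ n) x) (g x)) :
    IsReflexiveSpace 𝕜 X := by
  by_contra hrefl
  obtain ⟨c, hc, hJ⟩ := exists_james_sequences hrefl
  have hcpos : 0 < ‖c‖ := norm_pos_iff.2 hc
  obtain ⟨f, x, hf, hx, hlow, hhigh⟩ := hJ (‖c‖ / 8) (by positivity)
  obtain ⟨φ, A, g, hφ, hA, hconv⟩ := H f fun n => by simpa using hf n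
  obtain ⟨F, hF, hclus⟩ := exists_bidual_cluster (𝕜 := 𝕜) x hx
  have hg (k : ℕ) : ‖g (x k) - 0‖ ≤ ‖c‖ / 4 := by
    -- Starting at `k + 1` gives `k < n ≤ φ n`, the side of the array where values are nearly `0`.
    obtain ⟨n, hn, hlt⟩ := (hA.isStronglyNull (hconv (x k))).exists_norm_lt hA
      (show 0 < ‖c‖ / 8 by positivity) (k + 1)
    have h1 := hlow k (φ n) (hn.trans hφ.le_apply)
    have h2 := norm_sub_norm_le (g (x k)) (f (φ n) (x k))
    rw [norm_sub_rev] at h2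
    rw [sub_zero]
    linarith
  have hFg := hclus g 0 _ (Eventually.of_forall hg)
  have hFf (n : ℕ) : ‖F (f n) - c‖ ≤ ‖c‖ / 8 :=
    hclus (f n) c _ ((eventually_ge_atTop n).mono fun k hk => hhigh n k hk)
  have hnull : IsStronglyNull A fun k => F (f (φ k) - g) := by
    refine hgen.isStronglyNull hA (C := 1 + ‖g‖) (fun k => ?_) ?_ hF
    · exact (norm_sub_le _ _).trans (by gcongr; exact hf _)
    · rintro _ ⟨y, -, rfl⟩
      simpa using hA.isStronglyNull (hconv y)
  obtain ⟨k, -, hk⟩ := hnull.exists_norm_lt hA (show 0 < ‖c‖ / 8 by positivity) 0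
  -- The three terms are bounded by `‖c‖` times `1/8`, `1/8` and `1/4`.
  have h3 : ‖c‖ ≤ ‖F (f (φ k)) - c‖ + ‖F (f (φ k) - g)‖ + ‖F g - 0‖ := by
    have : c = -(F (f (φ k)) - c) + F (f (φ k) - g) + (F g - 0) := by
      rw [map_sub]
      ring
    calc ‖c‖ = ‖-(F (f (φ k)) - c) + F (f (φ k) - g) + (F g - 0)‖ := by rw [← this]
      _ ≤ ‖-(F (f (φ k)) - c)‖ + ‖F (f (φ k) - g)‖ + ‖F g - 0‖ := norm_add₃_le
      _ = _ := by rw [norm_neg]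
  linarith [hFf (φ k)]

end Reflexivity

/-! ### From statistical to strong Cesàro convergence -/

section Cesaro

/-- The matrix of arithmetic means. -/
noncomputable def cesaroMatrix (n k : ℕ) : ℝ := if k < n then (n : ℝ)⁻¹ else 0

theorem cesaroMatrix_eq_zero {n k : ℕ} (h : k ∉ Finset.range n) : cesaroMatrix n k = 0 := by
  simpa [cesaroMatrix] using fun h' => absurd (Finset.mem_range.2 h') h

theorem cesaroMatrix_of_mem {n k : ℕ} (h : k ∈ Finset.range n) :
    cesaroMatrix n k = (n : ℝ)⁻¹ :=
  if_pos (Finset.mem_range.1 h)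

theorem isPositiveRegularMatrix_cesaroMatrix : IsPositiveRegularMatrix cesaroMatrix where
  nonneg n k := by
    unfold cesaroMatrix
    positivity
  regular s l hs := by
    refine ⟨fun n => (n : ℝ)⁻¹ • ∑ k ∈ Finset.range n, s k, fun n => ?_, hs.cesaro_smul⟩
    refine tendsto_const_nhds.congr' ?_
    filter_upwards [eventually_ge_atTop n] with N hN
    rw [← Finset.sum_subset (Finset.range_mono hN) (fun k _ hk => by
      rw [cesaroMatrix_eq_zero hk, Complex.ofReal_zero, zero_mul]), Finset.smul_sum]
    refine Finset.sum_congr rfl fun k hk => ?_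
    rw [cesaroMatrix_of_mem hk, Complex.real_smul]

/-- Bounded statistically convergent sequences are strongly Cesàro convergent. -/
theorem IsStatisticallyConvergent.isStronglyConvergent {𝕜 : Type*} [RCLike 𝕜] {s : ℕ → 𝕜} {l : 𝕜}
    (h : IsStatisticallyConvergent s l) {C : ℝ} (hC : ∀ k, ‖s k - l‖ ≤ C) :
    IsStronglyConvergent cesaroMatrix s l := by
  classical
  have hzero (n k : ℕ) (hk : k ∉ Finset.range n) : cesaroMatrix n k * ‖s k - l‖ = 0 := by
    rw [cesaroMatrix_eq_zero hk, zero_mul]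
  refine ⟨fun n => summable_of_ne_finset_zero (hzero n), ?_⟩
  have hC0 : 0 ≤ C := (norm_nonneg _).trans (hC 0)
  have htsum (n : ℕ) :
      ∑' k, cesaroMatrix n k * ‖s k - l‖ = (∑ k ∈ Finset.range n, ‖s k - l‖) / n := by
    rw [tsum_eq_sum (hzero n), Finset.sum_div]
    refine Finset.sum_congr rfl fun k hk => ?_
    rw [cesaroMatrix_of_mem hk, inv_mul_eq_div]
  simp only [htsum]
  rw [Metric.tendsto_atTop']
  intro ε hε
  -- Exceptional indices contribute at most `C` times their proportion, hence less than `ε / 2`; the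
  -- others at most `ε / 2`.
  obtain ⟨N, hN⟩ := eventually_atTop.1
    ((h (ε / 2) (half_pos hε)).eventually_lt_const (show 0 < ε / (2 * (C + 1)) by positivity))
  refine ⟨N, fun n hn => ?_⟩
  have hn0 : (0 : ℝ) < n := by exact_mod_cast (Nat.zero_le N).trans_lt hn
  have hcard := hN n hn.le
  rw [Real.dist_0_eq_abs, abs_of_nonneg (by positivity)]
  set T := (Finset.range n).filter fun k => ε / 2 ≤ ‖s k - l‖ with hT
  have h1 : ∑ k ∈ Finset.range n, ‖s k - l‖ ≤ n * (ε / 2) + T.card * C := by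
    calc ∑ k ∈ Finset.range n, ‖s k - l‖
        ≤ ∑ k ∈ Finset.range n, (ε / 2 + if ε / 2 ≤ ‖s k - l‖ then C else 0) := by
          refine Finset.sum_le_sum fun k _ => ?_
          split_ifs with hk
          · linarith [hC k]
          · linarith
      _ = n * (ε / 2) + T.card * C := by
          rw [Finset.sum_add_distrib, ← Finset.sum_filter]
          simp [hT]
  have h2 : (T.card : ℝ) / n < ε / (2 * (C + 1)) := by
    convert hcard
  rw [div_lt_div_iff₀ hn0 (by positivity)] at h2
  rw [div_lt_iff₀ hn0]
  nlinarith [(Nat.cast_nonneg T.card : (0 : ℝ) ≤ T.card)]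

end Cesaro


theorem corollary3p8 {𝕜 : Type*} [RCLike 𝕜] {X : Type*} [NormedAddCommGroup X]
    [NormedSpace 𝕜 X] [CompleteSpace X]
    (hgen : IGenerates
      (NormedSpace.inclusionInDoubleDual 𝕜 X '' Metric.closedBall (0 : X) 1)
      (Metric.closedBall (0 : StrongDual 𝕜 (StrongDual 𝕜 X)) 1)) :
    ((∀ f : ℕ → StrongDual 𝕜 X,
        (∀ n, f n ∈ Metric.closedBall (0 : StrongDual 𝕜 X) 1) →
          ∃ (A : ℕ → ℕ → ℝ) (g : StrongDual 𝕜 X), IsPositiveRegularMatrix A ∧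
            ∀ x : X, IsStronglyConvergent A (fun n => f n x) (g x)) →
      IsReflexiveSpace 𝕜 X) ∧
    (IsWeakStarStatSeqCompact (Metric.closedBall (0 : StrongDual 𝕜 X) 1) →
      IsReflexiveSpace 𝕜 X) := by
  refine ⟨fun H => isReflexiveSpace_of_iGenerates hgen fun f hf => ?_,
    fun H => isReflexiveSpace_of_iGenerates hgen fun f hf => ?_⟩
  · obtain ⟨A, g, hA, hg⟩ := H f hf
    exact ⟨id, A, g, strictMono_id, hA, hg⟩
  · obtain ⟨φ, g, hφ, hg⟩ := H f hf
    refine ⟨φ, cesaroMatrix, g, hφ, isPositiveRegularMatrix_cesaroMatrix, fun x => ?_⟩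
    refine (hg x).isStronglyConvergent (C := (1 + ‖g‖) * ‖x‖) fun k => ?_
    have h1 : ‖f (φ k) - g‖ ≤ 1 + ‖g‖ :=
      (norm_sub_le _ _).trans (by gcongr; simpa using hf (φ k))
    exact (f (φ k) - g).le_of_opNorm_le h1 x
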